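/- Conventions. $\mathcal F f(\xi)=\int_{\mathbb R} f(x)e^{-2\pi i x\xi}\,dx$, extended to tempered distributions by duality; $T_\lambda\chi(t)=\chi(t-\lambda)$; $\mathcal D(\Omega)$ is the space of complex-valued $C^\infty$ functions with compact support in the open set $\Omega$. For $1\le p\le\infty$, $\mathcal FL^p(\mathbb R)=\{f\in\mathcal S'(\mathbb R) : \mathcal F^{-1}f\in L^p(\mathbb R)\}$ with norm $\|f\|_{\mathcal FL^p}=\|\mathcal F^{-1}f\|_{L^p}$. For $\psi\in\mathcal D((-\tfrac12,\tfrac12))\setminus\{0\}$, the discrete space $(\mathcal FL^p)^0_d(\mathbb Z)$ consists of all sequences $c=(c_\lambda)_{\lambda\in\mathbb Z}\in\mathbb C^{\mathbb Z}$ such that the distribution given by the locally finite sum $\sum_{\lambda\in\mathbb Z}c_\lambda T_\lambda\psi$ belongs to $\mathcal FL^p(\mathbb R)$; this space does not depend on the choice of $\psi$, and below membership is asserted for every such $\psi$ simultaneously. Proposition. Let $\chi\in\mathcal D((-\tfrac12,\tfrac12))\setminus\{0\}$. For every $1\le p<\infty$ with $p\ne2$ there exists $c\in(\mathcal FL^p)^0_d(\mathbb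 Z)$ such that the series $\sum_{\lambda\in\mathbb Z}c_\lambda T_\lambda\chi$ is not unconditionally convergent in $\mathcal FL^p(\mathbb R)$. For $p=1$ there even exists $c\in(\mathcal FL^1)^0_d(\mathbb Z)$ such that the sequence of symmetric partial sums $\bigl(\sum_{|\lambda|\le N}c_\lambda T_\lambda\chi\bigr)_{N\in\mathbb N}$ does not converge in $\mathcal FL^1(\mathbb R)$. -/

import Mathlib

open MeasureTheory Filter Topology
open scoped ENNReal SchwartzMap FourierTransform Distributions

noncomputable section

/-- A test function, regarded as a Schwartz function. -/
def testToSchwartz {Ω : TopologicalSpace.Opens ℝ} (χ : 𝓓(Ω, ℂ)) : 𝓢(ℝ, ℂ) :=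
  χ.hasCompactSupport.toSchwartzMap χ.contDiff

/-- The translate `T_x χ (t) = χ (t - x)` of a test function, as a Schwartz function. -/
def translateTest {Ω : TopologicalSpace.Opens ℝ} (χ : 𝓓(Ω, ℂ)) (x : ℝ) : 𝓢(ℝ, ℂ) :=
  (testToSchwartz χ).compSubConstCLM ℂ x

theorem translateTest_apply {Ω : TopologicalSpace.Opens ℝ} (χ : 𝓓(Ω, ℂ)) (x t : ℝ) :
    translateTest χ x t = χ (t - x) := rfl

/-- `𝓕 L^p(ℝ)`: the tempered distributions `f` such that `𝓕⁻¹ f` belongs to `L^p(ℝ)`, as a linear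
subspace of `𝓢'(ℝ)`. (The Fourier transform is `∫ f(x) exp(-2πixξ) dx`.) -/
def fourierLpSubmodule (p : ℝ≥0∞) [Fact (1 ≤ p)] : Submodule ℂ 𝓢'(ℝ, ℂ) where
  carrier := {f | ∃ g : Lp ℂ p (volume : Measure ℝ), 𝓕⁻ f = (g : 𝓢'(ℝ, ℂ))}
  zero_mem' := ⟨0, by
    rw [← Lp.toTemperedDistributionCLM_apply, map_zero, FourierTransform.fourierInv_zero]⟩
  add_mem' := by
    rintro f₁ f₂ ⟨g₁, h₁⟩ ⟨g₂, h₂⟩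
    exact ⟨g₁ + g₂, by
      rw [FourierTransform.fourierInv_add, h₁, h₂]
      simp only [← Lp.toTemperedDistributionCLM_apply, map_add]⟩
  smul_mem' := by
    rintro a f ⟨g, h⟩
    exact ⟨a • g, by
      rw [FourierTransform.fourierInv_smul, h]
      simp only [← Lp.toTemperedDistributionCLM_apply, map_smul]⟩

/-- The space `𝓕 L^p(ℝ)` as a type of its own, so that it carries the topology of its norm (below)
and not the one induced by `𝓢'(ℝ)`. -/
def FourierLp (p : ℝ≥0∞) [Fact (1 ≤ p)] : Type := fourierLpSubmodule p

namespace FourierLp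

variable {p : ℝ≥0∞} [Fact (1 ≤ p)]

instance : AddCommGroup (FourierLp p) := inferInstanceAs (AddCommGroup (fourierLpSubmodule p))

instance : Module ℂ (FourierLp p) := inferInstanceAs (Module ℂ (fourierLpSubmodule p))

/-- The inclusion `𝓕 L^p(ℝ) ⊆ 𝓢'(ℝ)`. -/
def toTempered : FourierLp p →ₗ[ℂ] 𝓢'(ℝ, ℂ) := (fourierLpSubmodule p).subtype

theorem toTempered_injective : Function.Injective (toTempered (p := p)) :=
  (fourierLpSubmodule p).injective_subtype

theorem exists_preimage (f : FourierLp p) :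
    ∃ g : Lp ℂ p (volume : Measure ℝ), 𝓕⁻ (toTempered f) = (g : 𝓢'(ℝ, ℂ)) := f.2

theorem toTemperedDistribution_injective :
    Function.Injective (Lp.toTemperedDistributionCLM ℂ (volume : Measure ℝ) p) :=
  LinearMap.ker_eq_bot.1 Lp.ker_toTemperedDistributionCLM_eq_bot

/-- The inverse Fourier transform `𝓕 L^p(ℝ) → L^p(ℝ)`, sending `f` to the unique `g ∈ L^p(ℝ)` with
`𝓕⁻¹ f = g` in `𝓢'(ℝ)` (see `fourierInv_toTempered`). -/
def inverseFourier : FourierLp p →ₗ[ℂ] Lp ℂ p (volume : Measure ℝ) where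
  toFun f := (exists_preimage f).choose
  map_add' f₁ f₂ := by
    have h := (exists_preimage (f₁ + f₂)).choose_spec
    have h₁ := (exists_preimage f₁).choose_spec
    have h₂ := (exists_preimage f₂).choose_spec
    apply toTemperedDistribution_injective
    refine (h.symm.trans ?_).trans (map_add _ _ _).symm
    rw [map_add, FourierTransform.fourierInv_add]
    exact congrArg₂ (· + ·) h₁ h₂
  map_smul' a f := by
    have h := (exists_preimage (a • f)).choose_spec
    have h₁ := (exists_preimage f).choose_spec
    apply toTemperedDistribution_injective
    refine (h.symm.trans ?_).trans (map_smul _ _ _).symm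
    rw [map_smul, FourierTransform.fourierInv_smul]
    exact congrArg (a • ·) h₁

theorem fourierInv_toTempered (f : FourierLp p) :
    𝓕⁻ (toTempered f) = (inverseFourier f : 𝓢'(ℝ, ℂ)) :=
  (exists_preimage f).choose_spec

theorem inverseFourier_injective : Function.Injective (inverseFourier (p := p)) := by
  intro f₁ f₂ h
  apply toTempered_injective
  have h' : 𝓕⁻ (toTempered f₁) = 𝓕⁻ (toTempered f₂) := by
    rw [fourierInv_toTempered, fourierInv_toTempered, h]
  simpa only [FourierTransform.fourier_fourierInv_eq] using
    congrArg (fun u : 𝓢'(ℝ, ℂ) => (𝓕 u : 𝓢'(ℝ, ℂ))) h'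

/-- The norm of `𝓕 L^p(ℝ)` is `‖f‖ = ‖𝓕⁻¹ f‖_{L^p}`. -/
instance : NormedAddCommGroup (FourierLp p) :=
  NormedAddCommGroup.induced (FourierLp p) (Lp ℂ p (volume : Measure ℝ)) inverseFourier
    inverseFourier_injective

theorem norm_def (f : FourierLp p) : ‖f‖ = ‖inverseFourier f‖ := rfl

instance : NormedSpace ℂ (FourierLp p) where
  norm_smul_le a f := by rw [norm_def, norm_def, map_smul, norm_smul]

/-- Every Schwartz function belongs to `𝓕 L^p(ℝ)`. -/
def ofSchwartz (p : ℝ≥0∞) [Fact (1 ≤ p)] (f : 𝓢(ℝ, ℂ)) : FourierLp p :=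
  ⟨(f : 𝓢'(ℝ, ℂ)), (𝓕⁻ f).toLp p volume, by
    rw [Lp.toTemperedDistribution_toLp_eq]
    exact TemperedDistribution.fourierInv_toTemperedDistributionCLM_eq f⟩

theorem toTempered_ofSchwartz (f : 𝓢(ℝ, ℂ)) :
    toTempered (ofSchwartz p f) = (f : 𝓢'(ℝ, ℂ)) := rfl

end FourierLp

/-- The open interval `(-1/2, 1/2)`; its translates by integers are pairwise disjoint. -/
def unitCell : TopologicalSpace.Opens ℝ := ⟨Set.Ioo (-(1 / 2)) (1 / 2), isOpen_Ioo⟩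

/-- `S_χ(c) = ∑_{n ∈ ℤ} c_n T_n χ` for an arbitrary complex sequence `c`. For every `t` at most one
term `c_n χ(t - n)` is nonzero, so that the sum is locally finite. -/
def synthesis (χ : 𝓓(unitCell, ℂ)) (c : ℤ → ℂ) (t : ℝ) : ℂ :=
  ∑ᶠ n : ℤ, c n * χ (t - n)

/-- The discrete space `E_d^0(ℤ)` associated with a space `E ⊆ 𝓢'(ℝ)` through the window `χ`:
the sequences `c ∈ ℂ^ℤ` for which the distribution `S_χ(c) ∈ 𝓓'(ℝ)` belongs to `E`, that is,
for which some `u ∈ E` agrees with `S_χ(c)` on all test functions. -/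
def discreteSpace (E : Submodule ℂ 𝓢'(ℝ, ℂ)) (χ : 𝓓(unitCell, ℂ)) : Set (ℤ → ℂ) :=
  {c | ∃ u ∈ E, ∀ φ : 𝓓((⊤ : TopologicalSpace.Opens ℝ), ℂ),
    u (testToSchwartz φ) = ∫ t : ℝ, synthesis χ c t * φ t}

end

noncomputable section

/-! The inverse Fourier transform turns `∑ cₙ Tₙ χ` into `φ(x) ∑ cₙ e^{2πinx}` with `φ = 𝓕⁻¹ χ` a
fixed Schwartz function, so all norms are weighted `L^p` norms of trigonometric polynomials. The
sequences are built from dyadic blocks: block `k` occupies `[2^k, 2^(k+1))`. If the block norms are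
summable for every Schwartz weight, the sequence lies in the discrete space for every window
(`blockSeq_mem_discreteSpace`).

For `1 < p < ∞`, `p ≠ 2`, two choices of signs on a block of length `N` compete. The Dirichlet
kernel has weighted `L^r` norm `O(N^(1-1/r))`; the Rudin–Shapiro polynomials are `O(N^(1/2))`
uniformly, hence in every weighted `L^r`. Take the choice with the smaller bound in `L^p` as
coefficients, scaled so that the blocks are summable. Unconditional convergence would allow a switch
to the other choice, with block norms still tending to zero. But Plancherel (the translates of `χ`
are orthogonal) and Hölder bound the switched norm below by the `L²` mass divided by the norm in the
dual exponent, and this quotient stays away from zero (`exists_not_summable_of_signs`).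

For `p = 1` the blocks are Fejér kernels centred at a point `x₀` with `φ(x₀) ≠ 0`. A full kernel is
bounded in weighted `L¹`, while the first half of its coefficients gives a polynomial of norm at
least a multiple of `log N` (`log_le_eLpNorm_mul_half_fejer`). With weights `1/k` on the sparse set
`k = 2^i` the blocks are summable, yet partial sums stopping midway through a block never become
Cauchy. -/

/-- The finite partial sum of `∑ cₙ Tₙ χ` over `F`, as a Schwartz function. -/
def partialSynthesis (χ : 𝓓(unitCell, ℂ)) (c : ℤ → ℂ) (F : Finset ℤ) : 𝓢(ℝ, ℂ) :=
  ∑ n ∈ F, c n • translateTest χ (n : ℝ)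

/-! ### Characters, and partial sums under the inverse Fourier transform. -/

/-- The character `x ↦ exp (2πix)`. -/
def character (x : ℝ) : ℂ := Complex.exp (2 * Real.pi * Complex.I * x)

theorem character_add (x y : ℝ) : character (x + y) = character x * character y := by
  simp only [character, ← Complex.exp_add]; congr 1; push_cast; ring

theorem character_nat_mul (n : ℕ) (x : ℝ) : character (n * x) = character x ^ n := by
  simp only [character, ← Complex.exp_nat_mul]; congr 1; push_cast; ring

theorem norm_character (x : ℝ) : ‖character x‖ = 1 := by
  rw [character, Complex.norm_exp]; simp

theorem character_intCast (n : ℤ) : character n = 1 := by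
  rw [character, Complex.exp_eq_one_iff]; exact ⟨n, by push_cast; ring⟩

theorem continuous_character : Continuous character := by
  unfold character; fun_prop

theorem partialSynthesis_apply (χ : 𝓓(unitCell, ℂ)) (c : ℤ → ℂ) (F : Finset ℤ) (t : ℝ) :
    partialSynthesis χ c F t = ∑ n ∈ F, c n * χ (t - n) := by
  simp [partialSynthesis, translateTest_apply]

theorem testToSchwartz_apply {Ω : TopologicalSpace.Opens ℝ} (χ : 𝓓(Ω, ℂ)) (t : ℝ) :
    testToSchwartz χ t = χ t := rfl

theorem fourierInv_translateTest_apply {Ω : TopologicalSpace.Opens ℝ} (χ : 𝓓(Ω, ℂ)) (a x : ℝ) :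
    𝓕⁻ (translateTest χ a) x = 𝓕⁻ (testToSchwartz χ) x * character (a * x) := by
  rw [SchwartzMap.fourierInv_coe, SchwartzMap.fourierInv_coe, Real.fourierInv_eq',
    Real.fourierInv_eq', ← integral_mul_const]
  rw [← integral_add_right_eq_self _ a]
  refine integral_congr_ae (Eventually.of_forall fun t => ?_)
  simp only [translateTest_apply, testToSchwartz_apply, add_sub_cancel_right, smul_eq_mul,
    character, RCLike.inner_apply, conj_trivial]
  rw [mul_right_comm (Complex.exp _)]
  rw [← Complex.exp_add]
  congr 2
  push_cast
  ring

theorem fourierInv_sum_smul {ι : Type*} (F : Finset ι) (c : ι → ℂ) (f : ι → 𝓢(ℝ, ℂ)) :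
    𝓕⁻ (∑ n ∈ F, c n • f n) = ∑ n ∈ F, c n • 𝓕⁻ (f n) := by
  classical
  induction F using Finset.induction_on with
  | empty => simp [FourierTransform.fourierInv_zero]
  | insert a s ha ih =>
    rw [Finset.sum_insert ha, Finset.sum_insert ha, FourierTransform.fourierInv_add, ih,
      FourierTransform.fourierInv_smul]

theorem fourierInv_partialSynthesis_apply (χ : 𝓓(unitCell, ℂ)) (c : ℤ → ℂ) (F : Finset ℤ) (x : ℝ) :
    𝓕⁻ (partialSynthesis χ c F) x =
      𝓕⁻ (testToSchwartz χ) x * ∑ n ∈ F, c n * character (n * x) := by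
  rw [partialSynthesis, fourierInv_sum_smul, sum_apply, Finset.mul_sum]
  refine Finset.sum_congr rfl fun n _ => ?_
  rw [smul_apply, fourierInv_translateTest_apply, smul_eq_mul]
  ring

namespace FourierLp

variable {p : ℝ≥0∞} [Fact (1 ≤ p)]

theorem sum_smul_ofSchwartz (χ : 𝓓(unitCell, ℂ)) (c : ℤ → ℂ) (F : Finset ℤ) :
    ∑ n ∈ F, c n • ofSchwartz p (translateTest χ (n : ℝ)) =
      ofSchwartz p (partialSynthesis χ c F) := by
  apply toTempered_injective
  rw [map_sum, partialSynthesis, toTempered_ofSchwartz, map_sum]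
  exact Finset.sum_congr rfl fun n _ => by rw [map_smul, map_smul, toTempered_ofSchwartz]

theorem inverseFourier_ofSchwartz (f : 𝓢(ℝ, ℂ)) :
    inverseFourier (ofSchwartz p f) = (𝓕⁻ f).toLp p volume := by
  apply toTemperedDistribution_injective
  rw [Lp.toTemperedDistributionCLM_apply, Lp.toTemperedDistributionCLM_apply,
    ← fourierInv_toTempered, toTempered_ofSchwartz, Lp.toTemperedDistribution_toLp_eq]
  exact TemperedDistribution.fourierInv_toTemperedDistributionCLM_eq f

theorem norm_ofSchwartz (f : 𝓢(ℝ, ℂ)) :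
    ‖ofSchwartz p f‖ = (eLpNorm (𝓕⁻ f : 𝓢(ℝ, ℂ)) p volume).toReal := by
  rw [norm_def, inverseFourier_ofSchwartz]
  exact SchwartzMap.norm_toLp

end FourierLp

/-! ### Disjoint supports and Plancherel. -/

theorem apply_eq_zero_of_half_le_abs (χ : 𝓓(unitCell, ℂ)) {t : ℝ} (ht : 1 / 2 ≤ |t|) : χ t = 0 := by
  by_contra h
  have h1 : t ∈ Set.Ioo (-(1 / 2) : ℝ) (1 / 2) :=
    χ.tsupport_subset (subset_tsupport _ (Function.mem_support.2 h))
  have := abs_lt.2 ⟨h1.1, h1.2⟩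
  linarith

theorem eq_of_apply_sub_ne_zero (χ : 𝓓(unitCell, ℂ)) {t : ℝ} {m n : ℤ} (hm : χ (t - m) ≠ 0)
    (hn : χ (t - n) ≠ 0) : m = n := by
  have h1 : |t - m| < 1 / 2 := by
    by_contra h; exact hm (apply_eq_zero_of_half_le_abs χ (not_lt.1 h))
  have h2 : |t - n| < 1 / 2 := by
    by_contra h; exact hn (apply_eq_zero_of_half_le_abs χ (not_lt.1 h))
  rw [abs_lt] at h1 h2
  have h3 : ((m - n : ℤ) : ℝ) < 1 := by push_cast; linarith
  have h4 : (-1 : ℝ) < ((m - n : ℤ) : ℝ) := by push_cast; linarith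
  have h3 : m - n < 1 := by exact_mod_cast h3
  have h4 : -1 < m - n := by exact_mod_cast h4
  omega

/-- At each `t` at most one translate is nonzero, so squaring produces no cross terms. -/
theorem norm_sq_partialSynthesis_apply (χ : 𝓓(unitCell, ℂ)) (c : ℤ → ℂ) (F : Finset ℤ) (t : ℝ) :
    ‖partialSynthesis χ c F t‖ ^ 2 = ∑ n ∈ F, ‖c n‖ ^ 2 * ‖χ (t - n)‖ ^ 2 := by
  rw [partialSynthesis_apply]
  by_cases h : ∃ n ∈ F, χ (t - n) ≠ 0
  · obtain ⟨n, hn, hne⟩ := h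
    have h0 : ∀ m ∈ F, m ≠ n → χ (t - m) = 0 := fun m _ hmn => by
      by_contra h; exact hmn (eq_of_apply_sub_ne_zero χ h hne)
    rw [Finset.sum_eq_single n (fun m hm hmn => by rw [h0 m hm hmn, mul_zero])
      (fun h => absurd hn h), Finset.sum_eq_single n
      (fun m hm hmn => by rw [h0 m hm hmn]; simp) (fun h => absurd hn h), norm_mul, mul_pow]
  · push Not at h
    rw [Finset.sum_eq_zero fun m hm => by rw [h m hm, mul_zero],
      Finset.sum_eq_zero fun m hm => by rw [h m hm]; simp]
    simp

theorem integrable_norm_sq (f : 𝓢(ℝ, ℂ)) : Integrable fun t => ‖f t‖ ^ 2 := by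
  have := (f.memLp 2 volume).integrable_norm_pow (by norm_num)
  simpa using this

/-- Plancherel's identity for partial sums: the translates of `χ` are orthogonal. -/
theorem integral_norm_sq_fourierInv_partialSynthesis (χ : 𝓓(unitCell, ℂ)) (c : ℤ → ℂ)
    (F : Finset ℤ) :
    ∫ x, ‖𝓕⁻ (partialSynthesis χ c F) x‖ ^ 2 = (∑ n ∈ F, ‖c n‖ ^ 2) * ∫ t, ‖χ t‖ ^ 2 := by
  have h := SchwartzMap.integral_norm_sq_fourier (𝓕⁻ (partialSynthesis χ c F))
  rw [FourierTransform.fourier_fourierInv_eq] at h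
  rw [← h]
  simp_rw [norm_sq_partialSynthesis_apply]
  rw [integral_finsetSum, Finset.sum_mul]
  · refine Finset.sum_congr rfl fun n _ => ?_
    rw [integral_const_mul, integral_sub_right_eq_self (fun t => ‖χ t‖ ^ 2)]
  · intro n _
    exact (integrable_norm_sq (translateTest χ n)).const_mul _

theorem integral_norm_sq_pos (χ : 𝓓(unitCell, ℂ)) (hχ : χ ≠ 0) : 0 < ∫ t, ‖χ t‖ ^ 2 := by
  obtain ⟨t, ht⟩ : ∃ t, χ t ≠ 0 := by
    by_contra! h
    exact hχ (TestFunction.ext h)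
  have hc : Continuous fun t => ‖χ t‖ ^ 2 := (χ.continuous.norm).pow 2
  exact hc.integral_pos_of_hasCompactSupport_nonneg_nonzero
    (χ.hasCompactSupport.norm.comp_left (g := fun x : ℝ => x ^ 2) (by simp))
    (fun t => by positivity) (x := t) (by simpa using ht)

/-! ### Membership in the discrete space. -/

theorem toLp_fourierInv_apply_fourier {p : ℝ≥0∞} [Fact (1 ≤ p)] (h u : 𝓢(ℝ, ℂ)) :
    ((𝓕⁻ h).toLp p volume : 𝓢'(ℝ, ℂ)) (𝓕 u) = ∫ t, h t * u t := by
  have e : ((𝓕⁻ h).toLp p volume : 𝓢'(ℝ, ℂ)) = 𝓕⁻ (h : 𝓢'(ℝ, ℂ)) := by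
    rw [Lp.toTemperedDistribution_toLp_eq]
    exact (TemperedDistribution.fourierInv_toTemperedDistributionCLM_eq h).symm
  have e2 : 𝓕⁻ (h : 𝓢'(ℝ, ℂ)) (𝓕 u) = (h : 𝓢'(ℝ, ℂ)) u :=
    (TemperedDistribution.fourierInv_apply _ _).trans
      (by rw [FourierTransform.fourierInv_fourier_eq])
  refine (congrArg (fun T : 𝓢'(ℝ, ℂ) => T (𝓕 u)) e).trans (e2.trans ?_)
  refine (SchwartzMap.toTemperedDistributionCLM_apply_apply _ _ _).trans ?_
  refine integral_congr_ae (Eventually.of_forall fun t => ?_)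
  simp [mul_comm]

/-- A sequence belongs to the discrete space once its partial sums along an exhaustion of `ℤ` by
finite sets converge in norm. -/
theorem mem_discreteSpace_of_tendsto {p : ℝ≥0∞} [Fact (1 ≤ p)] (χ : 𝓓(unitCell, ℂ)) (c : ℤ → ℂ)
    (F : ℕ → Finset ℤ) (hF : ∀ n, c n ≠ 0 → ∀ᶠ K in atTop, n ∈ F K)
    (hC : CauchySeq fun K => FourierLp.ofSchwartz p (partialSynthesis χ c (F K))) :
    c ∈ discreteSpace (fourierLpSubmodule p) χ := by
  have hC' : CauchySeq fun K => (𝓕⁻ (partialSynthesis χ c (F K))).toLp p volume := by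
    rw [Metric.cauchySeq_iff] at hC ⊢
    intro ε hε
    obtain ⟨N, hN⟩ := hC ε hε
    refine ⟨N, fun m hm n hn => ?_⟩
    have := hN m hm n hn
    rwa [dist_eq_norm, FourierLp.norm_def, map_sub, FourierLp.inverseFourier_ofSchwartz,
      FourierLp.inverseFourier_ofSchwartz, ← dist_eq_norm] at this
  obtain ⟨g, hg⟩ := cauchySeq_tendsto_of_complete hC'
  refine ⟨𝓕 (g : 𝓢'(ℝ, ℂ)), ⟨g, FourierTransform.fourierInv_fourier_eq _⟩, fun φ => ?_⟩
  rw [TemperedDistribution.fourier_apply]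
  have h1 : Tendsto (fun K => ∫ t, partialSynthesis χ c (F K) t * φ t) atTop
      (𝓝 ((g : 𝓢'(ℝ, ℂ)) (𝓕 (testToSchwartz φ)))) := by
    have h2 := ((PointwiseConvergenceCLM.evalCLM (RingHom.id ℂ) ℂ
      (𝓕 (testToSchwartz φ))).continuous.comp
        (Lp.toTemperedDistributionCLM ℂ (volume : Measure ℝ) p).continuous).tendsto g |>.comp hg
    refine h2.congr fun K => ?_
    exact toLp_fourierInv_apply_fourier _ _
  -- The pairings are eventually constant: only finitely many translates meet the support of `φ`.
  refine tendsto_nhds_unique h1 (tendsto_const_nhds.congr' ?_)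
  obtain ⟨R, hR⟩ := φ.hasCompactSupport.isCompact.isBounded.subset_closedBall 0
  -- From `|t| ≤ R` and `|t - n| < 1/2` it follows that `|n| ≤ ⌈R⌉ + 1`.
  have h3 : ∀ᶠ K in atTop, ∀ n ∈ Finset.Icc (-(⌈R⌉ + 1)) (⌈R⌉ + 1), c n ≠ 0 → n ∈ F K := by
    rw [Filter.eventually_all_finset]
    intro n _
    by_cases hn : c n = 0
    · simp [hn]
    · filter_upwards [hF n hn] with K hK _ using hK
  filter_upwards [h3] with K hK
  refine integral_congr_ae (Eventually.of_forall fun t => ?_)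
  simp only
  by_cases ht : φ t = 0
  · simp [ht]
  congr 1
  have htR : |t| ≤ R := by
    have := hR (subset_tsupport _ (Function.mem_support.2 ht))
    simpa using this
  rw [partialSynthesis_apply, synthesis]
  refine finsum_eq_sum_of_support_subset _ fun n hn => ?_
  have hn' : c n * χ (t - n) ≠ 0 := hn
  have h5 : |t - n| < 1 / 2 := by
    by_contra h
    exact right_ne_zero_of_mul hn' (apply_eq_zero_of_half_le_abs χ (not_lt.1 h))
  refine hK n ?_ (left_ne_zero_of_mul hn')
  have hR2 := Int.le_ceil R
  rw [abs_le] at htR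
  rw [abs_lt] at h5
  rw [Finset.mem_Icc]
  constructor
  · have : ((-(⌈R⌉ + 1) : ℤ) : ℝ) ≤ n := by push_cast; linarith
    exact_mod_cast this
  · have : (n : ℝ) ≤ ((⌈R⌉ + 1 : ℤ) : ℝ) := by push_cast; linarith
    exact_mod_cast this

/-! ### Dirichlet kernels in weighted `L^q`. -/

/-- The trigonometric polynomial `∑_{j < N} b j exp (2πijx)`. -/
def trigPoly (N : ℕ) (b : ℕ → ℂ) (x : ℝ) : ℂ := ∑ j ∈ Finset.range N, b j * character x ^ j

theorem continuous_trigPoly (N : ℕ) (b : ℕ → ℂ) : Continuous (trigPoly N b) := by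
  have := continuous_character
  unfold trigPoly; fun_prop

theorem trigPoly_add_intCast (N : ℕ) (b : ℕ → ℂ) (x : ℝ) (n : ℤ) :
    trigPoly N b (x + n) = trigPoly N b x := by
  simp only [trigPoly, character_add, character_intCast, mul_one]

theorem norm_trigPoly_one_le (N : ℕ) (x : ℝ) : ‖trigPoly N 1 x‖ ≤ N := by
  refine (norm_sum_le _ _).trans ?_
  simp [norm_character]

theorem four_mul_abs_le_norm_one_sub_character {x : ℝ} (hx : |x| ≤ 1 / 2) :
    4 * |x| ≤ ‖1 - character x‖ := by
  have h : character x = Complex.exp (Complex.I * (2 * Real.pi * x : ℝ)) := by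
    rw [character]; congr 1; push_cast; ring
  rw [norm_sub_rev, h, Complex.norm_exp_I_mul_ofReal_sub_one, norm_mul, Real.norm_eq_abs,
    Real.norm_eq_abs, abs_two]
  have h2 : 2 * Real.pi * x / 2 = Real.pi * x := by ring
  have hpi := Real.pi_pos
  have h3 : 2 / Real.pi * |Real.pi * x| ≤ |Real.sin (Real.pi * x)| := by
    apply Real.mul_abs_le_abs_sin
    rw [abs_mul, abs_of_pos hpi]
    nlinarith
  rw [h2]
  rw [abs_mul, abs_of_pos hpi] at h3
  have h4 : 2 / Real.pi * (Real.pi * |x|) = 2 * |x| := by field_simp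
  linarith

theorem one_sub_mul_trigPoly_one (N : ℕ) (x : ℝ) :
    (1 - character x) * trigPoly N 1 x = 1 - character x ^ N := by
  simp only [trigPoly, Pi.one_apply, one_mul]
  exact mul_neg_geom_sum _ _

theorem norm_one_sub_character_pow_le (N : ℕ) (x : ℝ) : ‖1 - character x ^ N‖ ≤ 2 := by
  refine (norm_sub_le _ _).trans ?_
  rw [norm_pow, norm_character]; norm_num

theorem norm_trigPoly_one_mul_le (N : ℕ) {x : ℝ} (hx : |x| ≤ 1 / 2) :
    ‖trigPoly N 1 x‖ * (2 * |x|) ≤ 1 := by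
  have h1 := congrArg norm (one_sub_mul_trigPoly_one N x)
  rw [norm_mul] at h1
  have h2 := norm_one_sub_character_pow_le N x
  have h3 := mul_le_mul_of_nonneg_right (four_mul_abs_le_norm_one_sub_character hx)
    (norm_nonneg (trigPoly N 1 x))
  nlinarith

/-- The trivial bound `N` and the decay `1 / (2|x|)` merge into one profile in the variable `2Nx`.
Its power `q / 2` is integrable for `q > 1`, and rescaling then yields the order `N^(q-1)`. -/
theorem norm_trigPoly_one_sq_le (N : ℕ) {x : ℝ} (hx : |x| ≤ 1 / 2) :
    ‖trigPoly N 1 x‖ ^ 2 ≤ 2 * N ^ 2 * (1 + ‖2 * N * x‖ ^ 2)⁻¹ := by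
  rw [← div_eq_mul_inv, le_div_iff₀ (by positivity), norm_mul, norm_mul, Real.norm_two,
    Real.norm_natCast, Real.norm_eq_abs]
  have h1 := norm_trigPoly_one_le N x
  have h2 := norm_trigPoly_one_mul_le N hx
  have h3 : ‖trigPoly N 1 x‖ ^ 2 ≤ N ^ 2 := by gcongr
  have h4 : (‖trigPoly N 1 x‖ * (2 * |x|)) ^ 2 ≤ 1 := pow_le_one₀ (by positivity) h2
  have h5 := mul_le_mul_of_nonneg_right h4 (sq_nonneg (N : ℝ))
  nlinarith

/-- The `L^q` size of the Dirichlet kernel over a period. -/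
theorem lintegral_trigPoly_one_le {q : ℝ} (hq : 1 < q) :
    ∃ C : ℝ, 0 ≤ C ∧ ∀ N : ℕ, 1 ≤ N →
      ∫⁻ x in Set.Ioc (-(1 / 2) : ℝ) (1 / 2), ENNReal.ofReal (‖trigPoly N 1 x‖ ^ q) ≤
        ENNReal.ofReal (C * (N : ℝ) ^ (q - 1)) := by
  set g : ℝ → ℝ := fun x => ((1 : ℝ) + ‖x‖ ^ 2) ^ (-q / 2) with hg
  have hgi : Integrable g := integrable_rpow_neg_one_add_norm_sq (by simpa using hq)
  have hg0 : ∀ x, 0 ≤ g x := fun x => by positivity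
  refine ⟨2 ^ (q / 2) * (∫ x, g x) / 2, by have := integral_nonneg (μ := volume) (f := g) fun x => hg0 x; positivity,
    fun N hN => ?_⟩
  have hN' : (0 : ℝ) < N := by exact_mod_cast hN
  calc _ ≤ ∫⁻ x in Set.Ioc (-(1 / 2) : ℝ) (1 / 2),
        ENNReal.ofReal (2 ^ (q / 2) * N ^ q * g (2 * N * x)) := by
        refine setLIntegral_mono' measurableSet_Ioc fun x hx => ENNReal.ofReal_le_ofReal ?_
        have hx' : |x| ≤ 1 / 2 := abs_le.2 ⟨hx.1.le, hx.2⟩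
        have h := Real.rpow_le_rpow (by positivity) (norm_trigPoly_one_sq_le N hx')
          (show 0 ≤ q / 2 by linarith)
        rw [← Real.rpow_natCast, ← Real.rpow_mul (norm_nonneg _),
          Real.mul_rpow (by positivity) (by positivity), Real.mul_rpow (by positivity)
          (by positivity), ← Real.rpow_natCast (N : ℝ), ← Real.rpow_mul hN'.le,
          Real.inv_rpow (by positivity), ← Real.rpow_neg (by positivity)] at h
        have e : ((2 : ℕ) : ℝ) * (q / 2) = q := by push_cast; ring
        rw [e, ← neg_div] at h
        exact h
    _ ≤ ∫⁻ x, ENNReal.ofReal (2 ^ (q / 2) * N ^ q * g (2 * N * x)) := setLIntegral_le_lintegral _ _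
    _ = ENNReal.ofReal (∫ x, 2 ^ (q / 2) * N ^ q * g (2 * N * x)) := by
        rw [ofReal_integral_eq_lintegral_ofReal]
        · exact (hgi.comp_mul_left' (by positivity)).const_mul _
        · exact Eventually.of_forall fun x => by have := hg0 (2 * N * x); positivity
    _ = _ := by
        congr 1
        rw [integral_const_mul, Measure.integral_comp_mul_left, Real.rpow_sub_one hN'.ne',
          abs_of_pos (by positivity), smul_eq_mul]
        field_simp

theorem exists_rpow_norm_le (φ : 𝓢(ℝ, ℂ)) {q : ℝ} (hq : 1 ≤ q) :
    ∃ C : ℝ, 0 ≤ C ∧ ∀ x, ‖φ x‖ ^ q ≤ C * ((1 + |x|) ^ 2)⁻¹ := by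
  obtain ⟨K, hK⟩ : ∃ K : ℝ, ∀ x, (1 + |x|) ^ 2 * ‖φ x‖ ≤ K :=
    ⟨_, fun x => by
      simpa using SchwartzMap.one_add_le_sup_seminorm_apply (𝕜 := ℂ) (m := (2, 0)) le_rfl le_rfl φ x⟩
  have hK0 : 0 ≤ K := le_trans (by positivity) (hK 0)
  refine ⟨K ^ q, by positivity, fun x => ?_⟩
  have h1 : ‖φ x‖ ≤ K * ((1 + |x|) ^ 2)⁻¹ := by
    rw [← div_eq_mul_inv, le_div_iff₀ (by positivity), mul_comm]; exact hK x
  refine (Real.rpow_le_rpow (norm_nonneg _) h1 (by linarith)).trans ?_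
  rw [Real.mul_rpow hK0 (by positivity)]
  gcongr
  refine Real.rpow_le_self_of_le_one (by positivity) ?_ hq
  apply inv_le_one_of_one_le₀
  have := abs_nonneg x
  nlinarith

theorem summable_inv_one_add_abs_sq : Summable fun n : ℤ => ((1 + |(n : ℝ)|) ^ 2)⁻¹ := by
  have h : Summable fun n : ℕ => ((1 + (n : ℝ)) ^ 2)⁻¹ := by
    have := (summable_nat_add_iff 1).2 (Real.summable_nat_pow_inv (p := 2).2 (by norm_num))
    refine this.congr fun n => ?_
    push_cast; ring_nf
  refine Summable.of_nat_of_neg ?_ ?_ <;> simpa using h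

/-- Integrating a `1`-periodic function against the `q`-th power of a Schwartz function. -/
theorem lintegral_mul_periodic_le (φ : 𝓢(ℝ, ℂ)) {q : ℝ} (hq : 1 ≤ q) :
    ∃ C : ℝ, 0 ≤ C ∧ ∀ G : ℝ → ℝ≥0∞, Measurable G → (∀ x (n : ℤ), G (x + n) = G x) →
      ∫⁻ x, ENNReal.ofReal (‖φ x‖ ^ q) * G x ≤
        ENNReal.ofReal C * ∫⁻ x in Set.Ioc (-(1 / 2) : ℝ) (1 / 2), G x := by
  obtain ⟨K, hK0, hK⟩ := exists_rpow_norm_le φ hq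
  -- The factor `4` comes from `1 + |n| ≤ 2 (1 + |x|)` on the period cell centred at `n`.
  have hs := summable_inv_one_add_abs_sq.mul_left (K * 4)
  have hpos : ∀ n : ℤ, 0 ≤ K * 4 * ((1 + |(n : ℝ)|) ^ 2)⁻¹ := fun n => by positivity
  refine ⟨∑' n : ℤ, K * 4 * ((1 + |(n : ℝ)|) ^ 2)⁻¹, tsum_nonneg hpos, fun G hG hper => ?_⟩
  rw [ENNReal.ofReal_tsum_of_nonneg hpos hs, ← ENNReal.tsum_mul_right]
  have hU := iUnion_Ioc_add_intCast (-(1 / 2) : ℝ)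
  rw [← setLIntegral_univ, ← hU]
  refine (lintegral_iUnion_le _ _).trans (ENNReal.tsum_le_tsum fun n => ?_)
  calc _ ≤ ∫⁻ x in Set.Ioc (-(1 / 2) + n : ℝ) (-(1 / 2) + n + 1),
        ENNReal.ofReal (K * 4 * ((1 + |(n : ℝ)|) ^ 2)⁻¹) * G x := by
        refine setLIntegral_mono' measurableSet_Ioc fun x hx => ?_
        gcongr
        refine (hK x).trans ?_
        rw [mul_assoc]
        gcongr
        have h1 : |(n : ℝ)| ≤ |x| + 1 / 2 := by
          have h2 : |(n : ℝ) - x| ≤ 1 / 2 := abs_le.2 ⟨by linarith [hx.2], by linarith [hx.1]⟩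
          have h3 := abs_add_le ((n : ℝ) - x) x
          rw [sub_add_cancel] at h3
          linarith
        rw [← div_eq_mul_inv, inv_le_comm₀ (by positivity) (by positivity), inv_div,
          div_le_iff₀ (by norm_num)]
        have := abs_nonneg (n : ℝ)
        have := abs_nonneg x
        nlinarith
    _ = _ := by
        rw [lintegral_const_mul _ hG]
        congr 1
        have hmp : MeasurePreserving (fun x : ℝ => x + n) volume volume :=
          measurePreserving_add_right _ _
        rw [← hmp.setLIntegral_comp_preimage measurableSet_Ioc hG]
        simp only [hper]
        congr 2
        ext x
        simp only [Set.mem_preimage, Set.mem_Ioc]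
        constructor <;> rintro ⟨h1, h2⟩ <;> constructor <;> linarith

/-- The pointwise product of a Schwartz function and a Dirichlet kernel in `L^p`. -/
theorem eLpNorm_mul_dirichlet_le (φ : 𝓢(ℝ, ℂ)) {p : ℝ≥0∞} (hp : 1 < p) (hp' : p ≠ ∞) :
    ∃ C : ℝ, ∀ N : ℕ, 1 ≤ N →
      (eLpNorm (fun x => φ x * trigPoly N 1 x) p volume).toReal ≤
        C * (N : ℝ) ^ (1 - 1 / p.toReal) := by
  set q := p.toReal with hqdef
  have hq : 1 < q := by
    rw [hqdef, ← ENNReal.toReal_one]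
    exact (ENNReal.toReal_lt_toReal ENNReal.one_ne_top hp').2 hp
  obtain ⟨C, hC0, hC⟩ := lintegral_mul_periodic_le φ hq.le
  obtain ⟨D, hD0, hD⟩ := lintegral_trigPoly_one_le hq
  refine ⟨(C * D) ^ (1 / q), fun N hN => ENNReal.toReal_le_of_le_ofReal (by positivity) ?_⟩
  rw [eLpNorm_eq_lintegral_rpow_enorm_toReal (by positivity) hp', ← hqdef]
  have h1 : ∫⁻ x, ‖φ x * trigPoly N 1 x‖ₑ ^ q ≤
      ENNReal.ofReal (C * (D * (N : ℝ) ^ (q - 1))) := by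
    rw [ENNReal.ofReal_mul hC0]
    calc _ = ∫⁻ x, ENNReal.ofReal (‖φ x‖ ^ q) * ENNReal.ofReal (‖trigPoly N 1 x‖ ^ q) := by
          refine lintegral_congr fun x => ?_
          rw [← ENNReal.ofReal_mul (by positivity), ← Real.mul_rpow (norm_nonneg _) (norm_nonneg _),
            ← norm_mul, ← ofReal_norm, ENNReal.ofReal_rpow_of_nonneg (norm_nonneg _) (by linarith)]
      _ ≤ _ := hC _ (by
            have := (continuous_trigPoly N 1).norm.measurable
            exact (this.pow_const q).ennreal_ofReal) fun x n => by rw [trigPoly_add_intCast]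
      _ ≤ _ := by gcongr; exact hD N hN
  refine (ENNReal.rpow_le_rpow h1 (by positivity)).trans ?_
  rw [ENNReal.ofReal_rpow_of_nonneg (by positivity) (by positivity), ← mul_assoc,
    Real.mul_rpow (by positivity) (by positivity), ← Real.rpow_mul (by positivity)]
  have e : (q - 1) * (1 / q) = 1 - 1 / q := by field_simp
  rw [e]

/-! ### Rudin–Shapiro polynomials. -/

/-- The coefficients of the `k`-th pair of Rudin–Shapiro polynomials. -/
def rudinShapiro : ℕ → (ℕ → ℂ) × (ℕ → ℂ)
  | 0 => (1, 1)
  | k + 1 =>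
    (fun j => if j < 2 ^ k then (rudinShapiro k).1 j else (rudinShapiro k).2 (j - 2 ^ k),
      fun j => if j < 2 ^ k then (rudinShapiro k).1 j else -(rudinShapiro k).2 (j - 2 ^ k))

theorem rudinShapiro_eq_or (k j : ℕ) :
    ((rudinShapiro k).1 j = 1 ∨ (rudinShapiro k).1 j = -1) ∧
      ((rudinShapiro k).2 j = 1 ∨ (rudinShapiro k).2 j = -1) := by
  induction k generalizing j with
  | zero => simp [rudinShapiro]
  | succ k ih =>
    simp only [rudinShapiro]
    split_ifs
    · exact ⟨(ih j).1, (ih j).1⟩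
    · refine ⟨(ih _).2, ?_⟩
      rcases (ih (j - 2 ^ k)).2 with h | h <;> simp [h]

theorem trigPoly_add_self (N : ℕ) (a b : ℕ → ℂ) (x : ℝ) :
    trigPoly (N + N) (fun j => if j < N then a j else b (j - N)) x =
      trigPoly N a x + character x ^ N * trigPoly N b x := by
  rw [trigPoly, Finset.sum_range_add, trigPoly, trigPoly, Finset.mul_sum]
  congr 1
  · refine Finset.sum_congr rfl fun j hj => ?_
    rw [if_pos (Finset.mem_range.1 hj)]
  · refine Finset.sum_congr rfl fun j _ => ?_
    rw [if_neg (by omega), Nat.add_sub_cancel_left, pow_add]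
    ring

theorem norm_add_sq_add_norm_sub_sq (a b : ℂ) :
    ‖a + b‖ ^ 2 + ‖a - b‖ ^ 2 = 2 * (‖a‖ ^ 2 + ‖b‖ ^ 2) := by
  have := parallelogram_law_with_norm ℝ a b
  nlinarith

/-- The recursion sends the pair `(P, Q)` to `(P + z^N Q, P - z^N Q)` with `|z| = 1`, so the
parallelogram law doubles the sum of squares. -/
theorem norm_trigPoly_rudinShapiro_sq_add (k : ℕ) (x : ℝ) :
    ‖trigPoly (2 ^ k) (rudinShapiro k).1 x‖ ^ 2 + ‖trigPoly (2 ^ k) (rudinShapiro k).2 x‖ ^ 2 =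
      2 * 2 ^ k := by
  induction k with
  | zero => simp [rudinShapiro, trigPoly]; norm_num
  | succ k ih =>
    have h1 : trigPoly (2 ^ (k + 1)) (rudinShapiro (k + 1)).1 x =
        trigPoly (2 ^ k) (rudinShapiro k).1 x +
          character x ^ 2 ^ k * trigPoly (2 ^ k) (rudinShapiro k).2 x := by
      rw [← trigPoly_add_self, pow_succ, mul_two]; rfl
    have h2 : trigPoly (2 ^ (k + 1)) (rudinShapiro (k + 1)).2 x =
        trigPoly (2 ^ k) (rudinShapiro k).1 x -
          character x ^ 2 ^ k * trigPoly (2 ^ k) (rudinShapiro k).2 x := by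
      have h3 : trigPoly (2 ^ k) (fun j => -(rudinShapiro k).2 j) x =
          -trigPoly (2 ^ k) (rudinShapiro k).2 x := by
        simp [trigPoly]
      rw [sub_eq_add_neg, ← mul_neg, ← h3, ← trigPoly_add_self, pow_succ, mul_two]; rfl
    rw [h1, h2, norm_add_sq_add_norm_sub_sq, norm_mul, norm_pow, norm_character, one_pow, one_mul,
      ih, pow_succ]
    ring

theorem norm_trigPoly_rudinShapiro_le (k : ℕ) (x : ℝ) :
    ‖trigPoly (2 ^ k) (rudinShapiro k).1 x‖ ≤ 2 * ((2 : ℝ) ^ k) ^ (1 / 2 : ℝ) := by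
  rw [← Real.sqrt_eq_rpow]
  refine abs_le_of_sq_le_sq' ?_ (by positivity) |>.2
  rw [mul_pow, Real.sq_sqrt (by positivity)]
  have := norm_trigPoly_rudinShapiro_sq_add k x
  have h : (0 : ℝ) ≤ 2 ^ k := by positivity
  nlinarith [sq_nonneg ‖trigPoly (2 ^ k) (rudinShapiro k).2 x‖]

theorem eLpNorm_mul_rudinShapiro_le (φ : 𝓢(ℝ, ℂ)) (p : ℝ≥0∞) :
    ∃ C : ℝ, ∀ k : ℕ,
      (eLpNorm (fun x => φ x * trigPoly (2 ^ k) (rudinShapiro k).1 x) p volume).toReal ≤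
        C * ((2 : ℝ) ^ k) ^ (1 / 2 : ℝ) := by
  refine ⟨2 * (eLpNorm φ p volume).toReal, fun k => ?_⟩
  have h := eLpNorm_le_mul_eLpNorm_of_ae_le_mul (p := p) (μ := volume)
    (f := fun x => φ x * trigPoly (2 ^ k) (rudinShapiro k).1 x) (g := φ)
    (c := 2 * ((2 : ℝ) ^ k) ^ (1 / 2 : ℝ)) (Eventually.of_forall fun x => by
      rw [norm_mul, mul_comm]
      gcongr
      exact norm_trigPoly_rudinShapiro_le k x)
  have h2 := ENNReal.toReal_mono
    (ENNReal.mul_ne_top ENNReal.ofReal_ne_top (φ.eLpNorm_lt_top p volume).ne) h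
  rw [ENNReal.toReal_mul, ENNReal.toReal_ofReal (by positivity)] at h2
  linarith

/-! ### Dyadic blocks. -/

/-- The sequence on `ℤ` that lists `b k 0, …, b k (2 ^ k - 1)` on `[2 ^ k, 2 ^ (k + 1))` and vanishes
on the nonpositive integers. -/
def blockSeq (b : ℕ → ℕ → ℂ) (n : ℤ) : ℂ :=
  if 1 ≤ n then b (Nat.log 2 n.toNat) (n.toNat - 2 ^ Nat.log 2 n.toNat) else 0

theorem blockSeq_two_pow_add (b : ℕ → ℕ → ℂ) {k j : ℕ} (hj : j < 2 ^ k) :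
    blockSeq b ((2 ^ k + j : ℕ) : ℤ) = b k j := by
  have h1 : Nat.log 2 (2 ^ k + j) = k :=
    Nat.log_eq_of_pow_le_of_lt_pow (by omega) (by rw [pow_succ]; omega)
  have h2 : 0 < 2 ^ k := by positivity
  rw [blockSeq, if_pos (by omega), Int.toNat_natCast, h1, Nat.add_sub_cancel_left]

theorem sum_Ico_natCast {M : Type*} [AddCommMonoid M] (m N : ℕ) (f : ℤ → M) :
    ∑ n ∈ Finset.Ico (m : ℤ) ((m + N : ℕ) : ℤ), f n =
      ∑ j ∈ Finset.range N, f ((m + j : ℕ) : ℤ) := by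
  refine (Finset.sum_bij (fun j _ => ((m + j : ℕ) : ℤ)) ?_ ?_ ?_ ?_).symm
  · intro j hj
    rw [Finset.mem_range] at hj
    rw [Finset.mem_Ico]; omega
  · intro i _ j _ h; omega
  · intro n hn
    rw [Finset.mem_Ico] at hn
    exact ⟨(n - m).toNat, by rw [Finset.mem_range]; omega, by omega⟩
  · intros; rfl

/-- Moving a block to start at frequency `m` multiplies by the unimodular factor `character x ^ m`,
so block norms do not depend on position. -/
theorem norm_fourierInv_partialSynthesis_Ico (χ : 𝓓(unitCell, ℂ)) (c : ℤ → ℂ) (m N : ℕ) (x : ℝ) :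
    ‖𝓕⁻ (partialSynthesis χ c (Finset.Ico (m : ℤ) ((m + N : ℕ) : ℤ))) x‖ =
      ‖𝓕⁻ (testToSchwartz χ) x * trigPoly N (fun j => c ((m + j : ℕ) : ℤ)) x‖ := by
  rw [fourierInv_partialSynthesis_apply, sum_Ico_natCast]
  have h : ∑ j ∈ Finset.range N, c ((m + j : ℕ) : ℤ) * character ((((m + j : ℕ) : ℤ) : ℝ) * x) =
      character x ^ m * trigPoly N (fun j => c ((m + j : ℕ) : ℤ)) x := by
    rw [trigPoly, Finset.mul_sum]
    refine Finset.sum_congr rfl fun j _ => ?_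
    rw [Int.cast_natCast, character_nat_mul, pow_add]
    ring
  rw [h, norm_mul, norm_mul, norm_pow, norm_character, one_pow, one_mul, norm_mul]

theorem trigPoly_congr {N : ℕ} {a b : ℕ → ℂ} (h : ∀ j < N, a j = b j) : trigPoly N a = trigPoly N b := by
  ext x
  exact Finset.sum_congr rfl fun j hj => by rw [h j (Finset.mem_range.1 hj)]

theorem trigPoly_const_mul (N : ℕ) (a : ℂ) (b : ℕ → ℂ) (x : ℝ) :
    trigPoly N (fun j => a * b j) x = a * trigPoly N b x := by
  rw [trigPoly, trigPoly, Finset.mul_sum]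
  exact Finset.sum_congr rfl fun j _ => mul_assoc _ _ _

theorem norm_ofSchwartz_partialSynthesis_Ico {p : ℝ≥0∞} [Fact (1 ≤ p)] (χ : 𝓓(unitCell, ℂ))
    (c : ℤ → ℂ) (m N : ℕ) (a : ℂ) (b : ℕ → ℂ) (h : ∀ j < N, c ((m + j : ℕ) : ℤ) = a * b j) :
    ‖FourierLp.ofSchwartz p (partialSynthesis χ c (Finset.Ico (m : ℤ) ((m + N : ℕ) : ℤ)))‖ =
      ‖a‖ * (eLpNorm (fun x => 𝓕⁻ (testToSchwartz χ) x * trigPoly N b x) p volume).toReal := by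
  rw [FourierLp.norm_ofSchwartz]
  have e : eLpNorm (𝓕⁻ (partialSynthesis χ c (Finset.Ico (m : ℤ) ((m + N : ℕ) : ℤ))) : 𝓢(ℝ, ℂ)) p
      volume = eLpNorm (a • fun x => 𝓕⁻ (testToSchwartz χ) x * trigPoly N b x) p volume := by
    refine eLpNorm_congr_norm_ae (Eventually.of_forall fun x => ?_)
    rw [norm_fourierInv_partialSynthesis_Ico, trigPoly_congr h, trigPoly_const_mul]
    simp only [Pi.smul_apply, smul_eq_mul, norm_mul]
    ring
  rw [e, eLpNorm_const_smul, ENNReal.toReal_mul, toReal_enorm]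

theorem partialSynthesis_union (χ : 𝓓(unitCell, ℂ)) (c : ℤ → ℂ) {F G : Finset ℤ}
    (h : Disjoint F G) :
    partialSynthesis χ c (F ∪ G) = partialSynthesis χ c F + partialSynthesis χ c G :=
  Finset.sum_union h

theorem FourierLp.ofSchwartz_add {p : ℝ≥0∞} [Fact (1 ≤ p)] (f g : 𝓢(ℝ, ℂ)) :
    ofSchwartz p (f + g) = ofSchwartz p f + ofSchwartz p g := by
  apply toTempered_injective
  rw [map_add, toTempered_ofSchwartz, toTempered_ofSchwartz, toTempered_ofSchwartz, map_add]

/-- A block sequence whose blocks have summable norms for every Schwartz weight belongs to the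
discrete space. -/
theorem blockSeq_mem_discreteSpace {p : ℝ≥0∞} [Fact (1 ≤ p)] (a : ℕ → ℝ) (b : ℕ → ℕ → ℂ)
    (hb : ∀ φ : 𝓢(ℝ, ℂ), Summable fun k =>
      |a k| * (eLpNorm (fun x => φ x * trigPoly (2 ^ k) (b k) x) p volume).toReal)
    (ψ : 𝓓(unitCell, ℂ)) :
    blockSeq (fun k j => a k * b k j) ∈ discreteSpace (fourierLpSubmodule p) ψ := by
  set c := blockSeq (fun k j => a k * b k j) with hc
  refine mem_discreteSpace_of_tendsto ψ c (fun K => Finset.Ico 1 ((2 ^ K : ℕ) : ℤ)) ?_ ?_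
  · intro n hn
    have hn1 : 1 ≤ n := by
      by_contra h
      exact hn (by rw [hc, blockSeq, if_neg h])
    filter_upwards [eventually_ge_atTop n.toNat] with K hK
    have := (Nat.lt_two_pow_self (n := K))
    rw [Finset.mem_Ico]; omega
  · refine cauchySeq_of_summable_dist ((hb (𝓕⁻ (testToSchwartz ψ))).congr fun k => ?_)
    have e1 : Finset.Ico 1 ((2 ^ (k + 1) : ℕ) : ℤ) = Finset.Ico 1 ((2 ^ k : ℕ) : ℤ) ∪
        Finset.Ico ((2 ^ k : ℕ) : ℤ) ((2 ^ k + 2 ^ k : ℕ) : ℤ) := by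
      have : 0 < 2 ^ k := by positivity
      rw [pow_succ, mul_two, Finset.Ico_union_Ico_eq_Ico (by omega) (by omega)]
    have e2 : Disjoint (Finset.Ico 1 ((2 ^ k : ℕ) : ℤ))
        (Finset.Ico ((2 ^ k : ℕ) : ℤ) ((2 ^ k + 2 ^ k : ℕ) : ℤ)) :=
      Finset.Ico_disjoint_Ico_consecutive _ _ _
    rw [dist_comm, dist_eq_norm, e1, partialSynthesis_union _ _ e2, FourierLp.ofSchwartz_add,
      add_sub_cancel_left, norm_ofSchwartz_partialSynthesis_Ico ψ c (2 ^ k) (2 ^ k) (a k) (b k)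
        fun j hj => by rw [hc, blockSeq_two_pow_add _ hj]]
    simp

/-! ### Sign changes and the case `1 < p < ∞`, `p ≠ 2`. -/

/-- The terms of a summable family stay small in norm after arbitrary changes of sign. -/
theorem Summable.exists_norm_sum_sign_smul_lt {ι E : Type*} [NormedAddCommGroup E]
    [NormedSpace ℂ E] {f : ι → E} (hf : Summable f) {ε : ℝ} (hε : 0 < ε) :
    ∃ s : Finset ι, ∀ t : Finset ι, Disjoint t s → ∀ σ : ι → ℂ,
      (∀ n ∈ t, σ n = 1 ∨ σ n = -1) → ‖∑ n ∈ t, σ n • f n‖ < ε := by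
  classical
  have h1 : CauchySeq fun s : Finset ι => ∑ n ∈ s, f n := hf.hasSum.cauchySeq
  rw [cauchySeq_finset_iff_vanishing_norm] at h1
  obtain ⟨s, hs⟩ := h1 (ε / 2) (by positivity)
  refine ⟨s, fun t ht σ hσ => ?_⟩
  -- The positive and negative parts are both sums over sets disjoint from `s`, each below `ε / 2`.
  have e : ∑ n ∈ t, σ n • f n = ∑ n ∈ t with σ n = 1, f n - ∑ n ∈ t with ¬σ n = 1, f n := by
    rw [← Finset.sum_filter_add_sum_filter_not t (fun n => σ n = 1), sub_eq_add_neg,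
      ← Finset.sum_neg_distrib]
    congr 1
    · refine Finset.sum_congr rfl fun n hn => ?_
      rw [(Finset.mem_filter.1 hn).2, one_smul]
    · refine Finset.sum_congr rfl fun n hn => ?_
      have := (hσ n (Finset.mem_filter.1 hn).1).resolve_left (Finset.mem_filter.1 hn).2
      rw [this, neg_one_smul]
  rw [e]
  refine (norm_sub_le _ _).trans_lt ?_
  have h2 := hs _ (Finset.disjoint_of_subset_left (Finset.filter_subset (fun n => σ n = 1) t) ht)
  have h3 := hs _ (Finset.disjoint_of_subset_left (Finset.filter_subset (fun n => ¬σ n = 1) t) ht)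
  linarith

/-- Hölder for `f · f`; it serves as a lower bound for the `L^p` norm. -/
theorem integral_norm_sq_le_eLpNorm_mul_eLpNorm (f : 𝓢(ℝ, ℂ)) (p q : ℝ≥0∞)
    [p.HolderConjugate q] :
    ∫ x, ‖f x‖ ^ 2 ≤ (eLpNorm f p volume).toReal * (eLpNorm f q volume).toReal := by
  have h := eLpNorm_smul_le_mul_eLpNorm (p := p) (q := q) (r := 1) (μ := volume) (f := ⇑f)
    (φ := ⇑f) f.continuous.aestronglyMeasurable f.continuous.aestronglyMeasurable
  have h2 := ENNReal.toReal_mono (ENNReal.mul_ne_top (f.eLpNorm_lt_top _ _).ne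
    (f.eLpNorm_lt_top _ _).ne) h
  rw [ENNReal.toReal_mul] at h2
  refine le_trans (le_of_eq ?_) h2
  rw [eLpNorm_one_eq_lintegral_enorm, integral_eq_lintegral_of_nonneg_ae
    (f := fun x => ‖f x‖ ^ 2) (Eventually.of_forall fun x => by positivity)
    (f.continuous.norm.pow 2).aestronglyMeasurable]
  congr 1
  refine lintegral_congr fun x => ?_
  rw [← ofReal_norm, Pi.smul_apply', smul_eq_mul, norm_mul, sq]

/-- If the polynomials with signs `X` are of order `N ^ α` in `L^p`, those with signs `Y` of order
`N ^ (1 - β)` in the dual space and `α < β`, then changing the signs of a suitable series of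
dyadic blocks destroys its convergence. -/
theorem exists_not_summable_of_signs (χ : 𝓓(unitCell, ℂ)) (hχ : χ ≠ 0) {p q : ℝ≥0∞} [Fact (1 ≤ p)]
    [p.HolderConjugate q] {X Y : ℕ → ℕ → ℂ} (hX : ∀ k j, X k j = 1 ∨ X k j = -1)
    (hY : ∀ k j, Y k j = 1 ∨ Y k j = -1) {α β : ℝ} (hαβ : α < β)
    (hXb : ∀ φ : 𝓢(ℝ, ℂ), ∃ C : ℝ, ∀ k : ℕ,
      (eLpNorm (fun x => φ x * trigPoly (2 ^ k) (X k) x) p volume).toReal ≤ C * ((2 : ℝ) ^ k) ^ α)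
    (hYb : ∀ φ : 𝓢(ℝ, ℂ), ∃ C : ℝ, ∀ k : ℕ,
      (eLpNorm (fun x => φ x * trigPoly (2 ^ k) (Y k) x) q volume).toReal ≤
        C * ((2 : ℝ) ^ k) ^ (1 - β)) :
    ∃ c : ℤ → ℂ, (∀ ψ : 𝓓(unitCell, ℂ), c ∈ discreteSpace (fourierLpSubmodule p) ψ) ∧
      ¬ Summable (fun n : ℤ => c n • FourierLp.ofSchwartz p (translateTest χ (n : ℝ))) := by
  -- With `N = 2^k` and `a k = N^(-β)`, the `X` blocks are `O(N^(α-β))`, a geometric series, and the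
  -- dual norm of the `Y` block is at most `C N (a k)²`, matching its `L²` mass.
  set a : ℕ → ℝ := fun k => ((2 : ℝ) ^ k) ^ (-β) with ha
  have ha0 : ∀ k, 0 < a k := fun k => by positivity
  refine ⟨blockSeq (fun k j => a k * X k j), blockSeq_mem_discreteSpace a X fun φ => ?_,
    fun hsum => ?_⟩
  · obtain ⟨C, hC⟩ := hXb φ
    have hr : ∀ k : ℕ, ((2 : ℝ) ^ k) ^ (α - β) = ((2 : ℝ) ^ (α - β)) ^ k := fun k => by
      rw [← Real.rpow_natCast, ← Real.rpow_mul (by norm_num), mul_comm,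
        Real.rpow_mul (by norm_num), Real.rpow_natCast]
    refine Summable.of_nonneg_of_le (fun k => by positivity) (fun k => ?_)
      ((summable_geometric_of_lt_one (by positivity)
        (Real.rpow_lt_one_of_one_lt_of_neg one_lt_two (sub_neg.2 hαβ))).mul_left C)
    rw [abs_of_pos (ha0 k), ← hr]
    calc _ ≤ a k * (C * ((2 : ℝ) ^ k) ^ α) := by
          have := (ha0 k).le
          gcongr
          exact hC k
      _ = _ := by
          rw [ha, sub_eq_add_neg, Real.rpow_add (by positivity)]; ring
  · obtain ⟨C, hC⟩ := hYb (𝓕⁻ (testToSchwartz χ))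
    have hI := integral_norm_sq_pos χ hχ
    set I := ∫ t, ‖χ t‖ ^ 2
    have hC1 : 0 < |C| + 1 := by positivity
    obtain ⟨s, hs⟩ := hsum.exists_norm_sum_sign_smul_lt (div_pos hI hC1)
    obtain ⟨R, hR⟩ : ∃ R : ℕ, ∀ n ∈ s, n < R := by
      obtain ⟨R, hR⟩ := s.bddAbove
      exact ⟨R.toNat + 1, fun n hn => by have := hR hn; omega⟩
    -- Since `R < 2^R`, block `R` lies beyond all of `s`.
    set k := R
    set B := Finset.Ico ((2 ^ k : ℕ) : ℤ) ((2 ^ k + 2 ^ k : ℕ) : ℤ) with hB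
    have hdisj : Disjoint B s := by
      rw [Finset.disjoint_left]
      intro n hn hns
      have h1 := hR n hns
      have h2 := (Nat.lt_two_pow_self (n := k))
      rw [hB, Finset.mem_Ico] at hn
      omega
    -- As `X² = 1`, multiplying by `σ = XY` replaces the signs `X` by `Y`.
    set σ := blockSeq fun k j => X k j * Y k j with hσ
    have hmem : ∀ n ∈ B, ∃ j < 2 ^ k, n = ((2 ^ k + j : ℕ) : ℤ) := fun n hn => by
      rw [hB, Finset.mem_Ico] at hn
      exact ⟨(n - (2 ^ k : ℕ)).toNat, by omega, by omega⟩
    have hlt := hs B hdisj σ fun n hn => by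
      obtain ⟨j, hj, rfl⟩ := hmem n hn
      rw [hσ, blockSeq_two_pow_add _ hj]
      rcases hX k j with h | h <;> rcases hY k j with h' | h' <;> simp [h, h']
    set d : ℤ → ℂ := fun n => σ n * blockSeq (fun k j => a k * X k j) n with hd
    have hdv : ∀ j < 2 ^ k, d ((2 ^ k + j : ℕ) : ℤ) = a k * Y k j := fun j hj => by
      simp only [hd, hσ]
      rw [blockSeq_two_pow_add _ hj, blockSeq_two_pow_add _ hj]
      rcases hX k j with h | h <;> simp [h, mul_comm]
    have e : ∑ n ∈ B, σ n • (blockSeq (fun k j => a k * X k j) n •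
        FourierLp.ofSchwartz p (translateTest χ (n : ℝ))) =
        FourierLp.ofSchwartz p (partialSynthesis χ d B) := by
      rw [← FourierLp.sum_smul_ofSchwartz]
      exact Finset.sum_congr rfl fun n _ => smul_smul _ _ _
    have : Fact (1 ≤ q) := ⟨ENNReal.HolderConjugate.one_le q p⟩
    have hq : (eLpNorm (𝓕⁻ (partialSynthesis χ d B) : 𝓢(ℝ, ℂ)) q volume).toReal ≤
        a k * (C * ((2 : ℝ) ^ k) ^ (1 - β)) := by
      have h := norm_ofSchwartz_partialSynthesis_Ico (p := q) χ d (2 ^ k) (2 ^ k) (a k) (Y k) hdv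
      rw [FourierLp.norm_ofSchwartz, Complex.norm_real, Real.norm_of_nonneg (ha0 k).le] at h
      rw [hB, h]
      exact mul_le_mul_of_nonneg_left (hC k) (ha0 k).le
    rw [e, FourierLp.norm_ofSchwartz] at hlt
    -- The mass `N (a k)² I` is at most `A · C N (a k)²`; cancelling `N (a k)²` contradicts `A < I /
    -- (|C| + 1)`.
    have hH := integral_norm_sq_le_eLpNorm_mul_eLpNorm (𝓕⁻ (partialSynthesis χ d B)) p q
    rw [integral_norm_sq_fourierInv_partialSynthesis, hB, sum_Ico_natCast] at hH
    have hs2 : ∑ j ∈ Finset.range (2 ^ k), ‖d ((2 ^ k + j : ℕ) : ℤ)‖ ^ 2 = 2 ^ k * a k ^ 2 := by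
      rw [Finset.sum_congr rfl (g := fun _ => a k ^ 2)]
      · simp
      · intro j hj
        rw [hdv j (Finset.mem_range.1 hj), norm_mul, Complex.norm_real,
          Real.norm_of_nonneg (ha0 k).le]
        rcases hY k j with h | h <;> simp [h]
    rw [hs2, ← hB] at hH
    set A := (eLpNorm (𝓕⁻ (partialSynthesis χ d B) : 𝓢(ℝ, ℂ)) p volume).toReal
    have hA0 : 0 ≤ A := ENNReal.toReal_nonneg
    have h2 : a k * (C * ((2 : ℝ) ^ k) ^ (1 - β)) = C * (2 ^ k * a k ^ 2) := by
      simp only [ha]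
      rw [sub_eq_add_neg, Real.rpow_add (by positivity), Real.rpow_one]
      ring
    rw [h2] at hq
    have hw : 0 < 2 ^ k * a k ^ 2 := by have := ha0 k; positivity
    have h3 : 2 ^ k * a k ^ 2 * I ≤ 2 ^ k * a k ^ 2 * (A * (|C| + 1)) := by
      refine hH.trans ((mul_le_mul_of_nonneg_left hq hA0).trans ?_)
      nlinarith [le_abs_self C, mul_nonneg hA0 hw.le]
    have h4 := le_of_mul_le_mul_left h3 hw
    rw [lt_div_iff₀ hC1] at hlt
    linarith

/-- The case `1 < p < ∞`, `p ≠ 2`. -/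
theorem exists_not_summable_of_one_lt (χ : 𝓓(unitCell, ℂ)) (hχ : χ ≠ 0) {p : ℝ≥0∞} [Fact (1 ≤ p)]
    (hp1 : 1 < p) (hp : p ≠ ∞) (hp2 : p ≠ 2) :
    ∃ c : ℤ → ℂ, (∀ ψ : 𝓓(unitCell, ℂ), c ∈ discreteSpace (fourierLpSubmodule p) ψ) ∧
      ¬ Summable (fun n : ℤ => c n • FourierLp.ofSchwartz p (translateTest χ (n : ℝ))) := by
  have hpq : p.HolderConjugate p.conjExponent := ENNReal.HolderConjugate.conjExponent hp1.le
  set q := p.conjExponent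
  have hq1 : 1 < q := (ENNReal.HolderConjugate.lt_top_iff_one_lt p q).1 hp.lt_top
  have hq : q ≠ ∞ := ((ENNReal.HolderConjugate.lt_top_iff_one_lt q p).2 hp1).ne
  have hr1 : 1 < p.toReal := by
    rw [← ENNReal.toReal_one]; exact (ENNReal.toReal_lt_toReal ENNReal.one_ne_top hp).2 hp1
  have hinv : 1 / p.toReal + 1 / q.toReal = 1 := by
    have := ENNReal.HolderConjugate.inv_add_inv_eq_one p q
    have h := congrArg ENNReal.toReal this
    rw [ENNReal.toReal_add (by simp; positivity) (by simp; positivity)] at h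
    simpa using h
  have hr2 : p.toReal ≠ 2 := fun h => hp2 (by
    rw [← ENNReal.ofReal_toReal hp, h]; simp)
  have hD : ∀ r : ℝ≥0∞, 1 < r → r ≠ ∞ → ∀ φ : 𝓢(ℝ, ℂ), ∃ C : ℝ, ∀ k : ℕ,
      (eLpNorm (fun x => φ x * trigPoly (2 ^ k) 1 x) r volume).toReal ≤
        C * ((2 : ℝ) ^ k) ^ (1 - 1 / r.toReal) := fun r hr hr' φ => by
    obtain ⟨C, hC⟩ := eLpNorm_mul_dirichlet_le φ hr hr'
    exact ⟨C, fun k => by simpa using hC (2 ^ k) Nat.one_le_two_pow⟩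
  rcases hr2.lt_or_gt with h | h
  -- For `p < 2` the Dirichlet bound is the smaller one: `1 - 1/p < 1/2`.
  · refine exists_not_summable_of_signs χ hχ (q := q) (X := fun _ => 1)
      (Y := fun k => (rudinShapiro k).1) (α := 1 - 1 / p.toReal) (β := 1 / 2) (by simp)
      (fun k j => (rudinShapiro_eq_or k j).1) ?_ (hD p hp1 hp) fun φ => ?_
    · have : 1 / 2 < 1 / p.toReal := one_div_lt_one_div_of_lt (by linarith) h
      linarith
    · obtain ⟨C, hC⟩ := eLpNorm_mul_rudinShapiro_le φ q
      exact ⟨C, fun k => by convert hC k using 3; norm_num⟩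
  -- For `p > 2` the roles are exchanged, and `1/2 < 1/q = 1 - 1/p`.
  · refine exists_not_summable_of_signs χ hχ (q := q) (X := fun k => (rudinShapiro k).1)
      (Y := fun _ => 1) (α := 1 / 2) (β := 1 / q.toReal)
      (fun k j => (rudinShapiro_eq_or k j).1) (by simp) ?_
      (fun φ => eLpNorm_mul_rudinShapiro_le φ p) (hD q hq1 hq)
    have : 1 / p.toReal < 1 / 2 := one_div_lt_one_div_of_lt (by norm_num) h
    linarith

/-! ### Fejér kernels, their halves, and the case `p = 1`. -/

theorem one_sub_mul_sum_succ_mul_pow (M : ℕ) (z : ℂ) :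
    (1 - z) * ∑ j ∈ Finset.range M, ((j : ℂ) + 1) * z ^ j =
      ∑ j ∈ Finset.range M, z ^ j - M * z ^ M := by
  induction M with
  | zero => simp
  | succ M ih =>
    rw [Finset.sum_range_succ, Finset.sum_range_succ, mul_add, ih]
    push_cast
    ring

/-- The coefficients of the square of `∑_{j < M} z ^ j`. -/
def triangle (M j : ℕ) : ℂ := if j < M then (j : ℂ) + 1 else (M : ℂ) - 1 - ((j - M : ℕ) : ℂ)

theorem sum_triangle_mul_pow (M : ℕ) (z : ℂ) :
    ∑ j ∈ Finset.range (M + M), triangle M j * z ^ j = (∑ j ∈ Finset.range M, z ^ j) ^ 2 := by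
  have h1 : ∑ j ∈ Finset.range M, triangle M j * z ^ j =
      ∑ j ∈ Finset.range M, ((j : ℂ) + 1) * z ^ j :=
    Finset.sum_congr rfl fun j hj => by rw [triangle, if_pos (Finset.mem_range.1 hj)]
  have h2 : ∑ j ∈ Finset.range M, triangle M (M + j) * z ^ (M + j) =
      z ^ M * (M * ∑ j ∈ Finset.range M, z ^ j -
        ∑ j ∈ Finset.range M, ((j : ℂ) + 1) * z ^ j) := by
    rw [Finset.mul_sum, ← Finset.sum_sub_distrib, Finset.mul_sum]
    refine Finset.sum_congr rfl fun j _ => ?_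
    rw [triangle, if_neg (by omega), Nat.add_sub_cancel_left, pow_add]
    ring
  rw [Finset.sum_range_add, h1, h2]
  have h3 := one_sub_mul_sum_succ_mul_pow M z
  have h4 : (1 - z) * ∑ j ∈ Finset.range M, z ^ j = 1 - z ^ M := mul_neg_geom_sum _ _
  linear_combination (∑ j ∈ Finset.range M, z ^ j) * h3 -
    (∑ j ∈ Finset.range M, ((j : ℂ) + 1) * z ^ j) * h4

/-- The coefficients of the Fejér kernel of order `M`, translated by `x₀` and moved to nonnegative
frequencies. -/
def fejerCoeff (x₀ : ℝ) (M j : ℕ) : ℂ := (M : ℂ)⁻¹ * (triangle M j * character (-x₀) ^ j)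

theorem trigPoly_fejerCoeff (x₀ : ℝ) (M : ℕ) (x : ℝ) :
    trigPoly (M + M) (fejerCoeff x₀ M) x = (M : ℂ)⁻¹ * trigPoly M 1 (x - x₀) ^ 2 := by
  have h : fejerCoeff x₀ M = fun j => (M : ℂ)⁻¹ * (triangle M j * character (-x₀) ^ j) := rfl
  rw [h, trigPoly_const_mul]
  congr 1
  simp only [trigPoly, Pi.one_apply, one_mul]
  rw [← sum_triangle_mul_pow, sub_eq_add_neg, character_add]
  refine Finset.sum_congr rfl fun j _ => ?_
  rw [mul_pow]; ring

theorem trigPoly_half_fejerCoeff (x₀ : ℝ) (M : ℕ) (x : ℝ) :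
    trigPoly M (fejerCoeff x₀ M) x =
      (M : ℂ)⁻¹ * ∑ j ∈ Finset.range M, ((j : ℂ) + 1) * character (x - x₀) ^ j := by
  have h : fejerCoeff x₀ M = fun j => (M : ℂ)⁻¹ * (triangle M j * character (-x₀) ^ j) := rfl
  rw [h, trigPoly_const_mul]
  congr 1
  refine Finset.sum_congr rfl fun j hj => ?_
  have h' : triangle M j = j + 1 := if_pos (Finset.mem_range.1 hj)
  beta_reduce
  rw [h', sub_eq_add_neg, character_add, mul_pow]; ring

/-- Fejér kernels are bounded in weighted `L¹`. -/
theorem eLpNorm_mul_fejer_le (φ : 𝓢(ℝ, ℂ)) (x₀ : ℝ) :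
    ∃ C : ℝ, 0 ≤ C ∧ ∀ M : ℕ, 1 ≤ M →
      (eLpNorm (fun x => φ x * trigPoly (M + M) (fejerCoeff x₀ M) x) 1 volume).toReal ≤ C := by
  obtain ⟨C, hC0, hC⟩ := lintegral_mul_periodic_le (φ.compSubConstCLM ℂ (-x₀)) le_rfl
  obtain ⟨D, hD0, hD⟩ := lintegral_trigPoly_one_le one_lt_two
  refine ⟨C * D, by positivity, fun M hM => ENNReal.toReal_le_of_le_ofReal (by positivity) ?_⟩
  have hM' : (0 : ℝ) < M := by exact_mod_cast hM
  rw [eLpNorm_one_eq_lintegral_enorm, ← lintegral_add_right_eq_self _ x₀]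
  calc _ = ∫⁻ x, ENNReal.ofReal ((M : ℝ)⁻¹) *
        (ENNReal.ofReal (‖φ.compSubConstCLM ℂ (-x₀) x‖ ^ (1 : ℝ)) *
          ENNReal.ofReal (‖trigPoly M 1 x‖ ^ (2 : ℝ))) := by
        refine lintegral_congr fun x => ?_
        rw [← ENNReal.ofReal_mul (by positivity), ← ENNReal.ofReal_mul (by positivity),
          trigPoly_fejerCoeff, add_sub_cancel_right, ← ofReal_norm, norm_mul, norm_mul, norm_pow,
          norm_inv, Complex.norm_natCast, SchwartzMap.compSubConstCLM_apply, sub_neg_eq_add,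
          Real.rpow_one, Real.rpow_two]
        congr 1; ring
    _ = ENNReal.ofReal ((M : ℝ)⁻¹) * ∫⁻ x,
        ENNReal.ofReal (‖φ.compSubConstCLM ℂ (-x₀) x‖ ^ (1 : ℝ)) *
          ENNReal.ofReal (‖trigPoly M 1 x‖ ^ (2 : ℝ)) :=
        lintegral_const_mul' _ _ ENNReal.ofReal_ne_top
    _ ≤ ENNReal.ofReal ((M : ℝ)⁻¹) *
        (ENNReal.ofReal C * ENNReal.ofReal (D * (M : ℝ) ^ ((2 : ℝ) - 1))) := by
        gcongr
        refine (hC _ ?_ fun x n => by rw [trigPoly_add_intCast]).trans ?_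
        · exact ((continuous_trigPoly M 1).norm.measurable.pow_const (2 : ℝ)).ennreal_ofReal
        · gcongr; exact hD M hM
    _ = _ := by
        rw [← ENNReal.ofReal_mul hC0, ← ENNReal.ofReal_mul (by positivity)]
        congr 1
        have : (2 : ℝ) - 1 = 1 := by norm_num
        rw [this, Real.rpow_one]
        field_simp

theorem norm_one_sub_character_le (x : ℝ) : ‖1 - character x‖ ≤ 2 * Real.pi * |x| := by
  have h : character x = Complex.exp (Complex.I * (2 * Real.pi * x : ℝ)) := by
    rw [character]; congr 1; push_cast; ring
  rw [norm_sub_rev, h]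
  refine Real.norm_exp_I_mul_ofReal_sub_one_le.trans (le_of_eq ?_)
  rw [Real.norm_eq_abs, abs_mul, abs_of_pos (by positivity)]

/-- Truncating the triangle at its peak leaves the jump term `M z^M (1 - z)` in `(1 - z)² S`. For `t
≥ 1/M` it dominates `1 - z^M`, so `|S| / M` is at least of order `1 / t`. -/
theorem inv_le_norm_half_fejer {x₀ x : ℝ} {M : ℕ} (hM : 1 ≤ M) (h1 : (M : ℝ)⁻¹ ≤ x - x₀)
    (h2 : x - x₀ ≤ 1 / 2) :
    (4 * Real.pi)⁻¹ * (x - x₀)⁻¹ ≤ ‖trigPoly M (fejerCoeff x₀ M) x‖ := by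
  have hM' : (0 : ℝ) < M := by exact_mod_cast hM
  set t := x - x₀
  have ht : 0 < t := lt_of_lt_of_le (by positivity) h1
  set S := ∑ j ∈ Finset.range M, ((j : ℂ) + 1) * character t ^ j with hS
  have h3 := one_sub_mul_sum_succ_mul_pow M (character t)
  have h4 : (1 - character t) * ∑ j ∈ Finset.range M, character t ^ j = 1 - character t ^ M :=
    mul_neg_geom_sum _ _
  have h5 : (1 - character t) ^ 2 * S =
      (1 - character t ^ M) - M * character t ^ M * (1 - character t) := by
    linear_combination (1 - character t) * h3 + h4
  set u := ‖1 - character t‖ with hu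
  have hu1 : 4 * t ≤ u := by
    have := four_mul_abs_le_norm_one_sub_character (x := t) (by rwa [abs_of_pos ht])
    rwa [abs_of_pos ht] at this
  have hu2 : u ≤ 2 * Real.pi * t := by
    have := norm_one_sub_character_le t
    rwa [abs_of_pos ht] at this
  have h6 : M * u - 2 ≤ u ^ 2 * ‖S‖ := by
    have h7 : ‖M * character t ^ M * (1 - character t)‖ = M * u := by
      rw [norm_mul, norm_mul, norm_pow, norm_character, one_pow, mul_one, Complex.norm_natCast]
    have h8 := norm_sub_norm_le (M * character t ^ M * (1 - character t)) (1 - character t ^ M)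
    rw [norm_sub_rev (M * character t ^ M * (1 - character t)), ← h5, h7, norm_mul, norm_pow] at h8
    linarith [norm_one_sub_character_pow_le M t]
  have hMt : 1 ≤ M * t := by
    rwa [inv_le_iff_one_le_mul₀' hM'] at h1
  -- Here `M u ≥ 4 M t ≥ 4`, so subtracting `2` costs at most half.
  have h9 : M * u / 2 ≤ u ^ 2 * ‖S‖ := by nlinarith
  have hu0 : 0 < u := by linarith
  have h10 : M / 2 ≤ u * ‖S‖ := by
    refine le_of_mul_le_mul_left ?_ hu0
    nlinarith
  rw [trigPoly_half_fejerCoeff, norm_mul, norm_inv, Complex.norm_natCast, ← mul_inv]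
  rw [← div_eq_inv_mul, le_div_iff₀ hM', inv_mul_le_iff₀ (by positivity)]
  have h11 := mul_le_mul_of_nonneg_right hu2 (norm_nonneg S)
  have h12 : ‖∑ j ∈ Finset.range M, ((j : ℂ) + 1) * character (x - x₀) ^ j‖ = ‖S‖ := rfl
  rw [h12]
  nlinarith

theorem integrable_mul_trigPoly (φ : 𝓢(ℝ, ℂ)) (N : ℕ) (b : ℕ → ℂ) :
    Integrable fun x => φ x * trigPoly N b x := by
  refine φ.integrable.mul_bdd (c := ∑ j ∈ Finset.range N, ‖b j‖)
    (continuous_trigPoly N b).aestronglyMeasurable (Eventually.of_forall fun x => ?_)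
  refine (norm_sum_le _ _).trans (le_of_eq (Finset.sum_congr rfl fun j _ => ?_))
  rw [norm_mul, norm_pow, norm_character, one_pow, mul_one]

/-- The upper halves of the Fejér kernels are of logarithmic size in weighted `L¹`. -/
theorem log_le_eLpNorm_mul_half_fejer (φ : 𝓢(ℝ, ℂ)) {x₀ : ℝ} (hx₀ : φ x₀ ≠ 0) :
    ∃ δ > 0, ∃ η > (0 : ℝ), ∀ M : ℕ, 1 ≤ M → 1 ≤ M * η →
      δ * Real.log (M * η) ≤
        (eLpNorm (fun x => φ x * trigPoly M (fejerCoeff x₀ M) x) 1 volume).toReal := by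
  have hpos : 0 < ‖φ x₀‖ := norm_pos_iff.2 hx₀
  obtain ⟨r, hr, hball⟩ := Metric.eventually_nhds_iff_ball.1
    (φ.continuous.norm.continuousAt.eventually (lt_mem_nhds (half_lt_self hpos)))
  -- The bound `r / 2` keeps `‖φ‖` above `‖φ x₀‖ / 2`; the bound `1 / 2` keeps `x - x₀` within half
  -- a period.
  refine ⟨‖φ x₀‖ / 2 * (4 * Real.pi)⁻¹, by positivity, min (r / 2) (1 / 2), by positivity,
    fun M hM hMη => ?_⟩
  set η := min (r / 2) (1 / 2)
  have hη1 : η ≤ r / 2 := min_le_left _ _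
  have hη2 : η ≤ 1 / 2 := min_le_right _ _
  have hM' : (0 : ℝ) < M := by exact_mod_cast hM
  have hη0 : 0 < η := by positivity
  have hMη' : (M : ℝ)⁻¹ ≤ η := (inv_le_iff_one_le_mul₀' hM').2 hMη
  have hint := integrable_mul_trigPoly φ M (fejerCoeff x₀ M)
  rw [eLpNorm_one_eq_lintegral_enorm, ← integral_norm_eq_lintegral_enorm hint.aestronglyMeasurable]
  have hle : x₀ + (M : ℝ)⁻¹ ≤ x₀ + η := by linarith
  calc _ = ∫ x in (x₀ + (M : ℝ)⁻¹)..(x₀ + η), ‖φ x₀‖ / 2 * (4 * Real.pi)⁻¹ * (x - x₀)⁻¹ := by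
        rw [intervalIntegral.integral_const_mul,
          intervalIntegral.integral_comp_sub_right (fun x => x⁻¹), add_sub_cancel_left,
          add_sub_cancel_left, integral_inv_of_pos (by positivity) hη0, div_inv_eq_mul, mul_comm η]
    _ ≤ ∫ x in (x₀ + (M : ℝ)⁻¹)..(x₀ + η), ‖φ x * trigPoly M (fejerCoeff x₀ M) x‖ := by
        refine intervalIntegral.integral_mono_on hle ?_ hint.norm.intervalIntegrable fun x hx => ?_
        · refine ContinuousOn.intervalIntegrable ?_
          rw [Set.uIcc_of_le hle]
          refine continuousOn_const.mul (ContinuousOn.inv₀ (by fun_prop) fun x hx => ?_)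
          have : (0 : ℝ) < (M : ℝ)⁻¹ := by positivity
          linarith [hx.1]
        · rw [norm_mul, mul_assoc]
          have h1 := inv_le_norm_half_fejer (x₀ := x₀) (x := x) hM (by linarith [hx.1])
            (by linarith [hx.2])
          have hM'' : (0 : ℝ) < (M : ℝ)⁻¹ := by positivity
          have h2 : ‖φ x₀‖ / 2 < ‖φ x‖ := hball x (by
            rw [Metric.mem_ball, Real.dist_eq, abs_of_pos (by linarith [hx.1])]
            linarith [hx.2])
          have h3 : 0 < x - x₀ := by linarith [hx.1]
          gcongr
    _ ≤ _ := by
        rw [intervalIntegral.integral_of_le hle]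
        exact setIntegral_le_integral hint.norm (Eventually.of_forall fun x => norm_nonneg _)

/-- The weights `1 / k` for `k` a power of two, and `0` otherwise. -/
def dyadicWeight (k : ℕ) : ℝ := if 2 ^ Nat.log 2 k = k then (k : ℝ)⁻¹ else 0

theorem dyadicWeight_two_pow (i : ℕ) : dyadicWeight (2 ^ i) = (1 / 2) ^ i := by
  rw [dyadicWeight, Nat.log_pow one_lt_two, if_pos rfl]
  simp

/-- Sparsity makes the weights summable although `k * dyadicWeight k = 1` for infinitely many `k`,
which is what a loss of `log 2^k` requires. -/
theorem summable_dyadicWeight : Summable dyadicWeight := by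
  refine (Function.Injective.summable_iff (Nat.pow_right_injective le_rfl) fun k hk => ?_).1
    (summable_geometric_two.congr fun i => (dyadicWeight_two_pow i).symm)
  exact if_neg fun h => hk ⟨_, h⟩

theorem sum_Icc_neg_eq_sum_Ico {M : Type*} [AddCommMonoid M] (f : ℤ → M)
    (hf : ∀ n, n < 1 → f n = 0) (N : ℕ) :
    ∑ n ∈ Finset.Icc (-(N : ℤ)) N, f n = ∑ n ∈ Finset.Ico 1 ((N : ℤ) + 1), f n := by
  refine (Finset.sum_subset (fun n hn => ?_) fun n _ hn => hf n ?_).symm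
  · rw [Finset.mem_Ico] at hn; rw [Finset.mem_Icc]; omega
  · rw [Finset.mem_Ico] at hn; rw [Finset.mem_Icc] at *; omega

theorem exists_not_tendsto_symmetric (χ : 𝓓(unitCell, ℂ)) (hχ : χ ≠ 0) :
    ∃ c : ℤ → ℂ, (∀ ψ : 𝓓(unitCell, ℂ), c ∈ discreteSpace (fourierLpSubmodule 1) ψ) ∧
      ¬ ∃ f : FourierLp 1, Tendsto (fun N : ℕ => ∑ n ∈ Finset.Icc (-(N : ℤ)) (N : ℤ),
        c n • FourierLp.ofSchwartz 1 (translateTest χ (n : ℝ))) atTop (𝓝 f) := by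
  obtain ⟨x₀, hx₀⟩ : ∃ x₀, 𝓕⁻ (testToSchwartz χ) x₀ ≠ 0 := by
    by_contra! h
    have h1 : 𝓕⁻ (testToSchwartz χ) = 0 := SchwartzMap.ext h
    have h2 := FourierTransform.fourier_fourierInv_eq (F := 𝓢(ℝ, ℂ)) (testToSchwartz χ)
    rw [h1, FourierTransform.fourier_zero] at h2
    exact hχ (TestFunction.ext fun t => (congrArg (fun f : 𝓢(ℝ, ℂ) => f t) h2).symm)
  -- Order `2^(k-1)` makes the `2 · 2^(k-1)` coefficients fill block `k`. The truncated exponent at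
  -- `k = 0` is harmless, as the weight there vanishes.
  set b : ℕ → ℕ → ℂ := fun k => fejerCoeff x₀ (2 ^ (k - 1)) with hb
  have h2k : ∀ k, 1 ≤ k → 2 ^ k = 2 ^ (k - 1) + 2 ^ (k - 1) := fun k hk => by
    rw [← mul_two, ← pow_succ, Nat.sub_add_cancel hk]
  refine ⟨blockSeq fun k j => dyadicWeight k * b k j,
    blockSeq_mem_discreteSpace dyadicWeight b fun φ => ?_, ?_⟩
  · obtain ⟨C, hC0, hC⟩ := eLpNorm_mul_fejer_le φ x₀
    have hw : ∀ k, |dyadicWeight k| = dyadicWeight k := fun k =>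
      abs_of_nonneg (by unfold dyadicWeight; split_ifs <;> positivity)
    refine Summable.of_nonneg_of_le (fun k => by positivity) (fun k => ?_)
      (summable_dyadicWeight.mul_right C)
    rw [hw]
    rcases Nat.eq_zero_or_pos k with rfl | hk
    · simp [dyadicWeight]
    · refine mul_le_mul_of_nonneg_left ?_ ((abs_nonneg _).trans_eq (hw k))
      rw [h2k k hk]
      exact hC _ Nat.one_le_two_pow
  · rintro ⟨f, hf⟩
    set c := blockSeq fun k j => dyadicWeight k * b k j with hc
    obtain ⟨δ, hδ, η, hη, hlow⟩ := log_le_eLpNorm_mul_half_fejer _ hx₀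
    have hcau := hf.cauchySeq
    rw [Metric.cauchySeq_iff] at hcau
    have hlog2 : 0 < Real.log 2 := Real.log_pos one_lt_two
    -- The threshold is `(1/k) · δ · (k/4) log 2`, the lower bound obtained for half a block.
    obtain ⟨N₀, hN₀⟩ := hcau (δ * Real.log 2 / 4) (by positivity)
    obtain ⟨L, hL⟩ := exists_nat_ge (|Real.log η| / Real.log 2)
    -- The terms `4L + 4` give `(k - 1) log 2 + log η ≥ (k/4) log 2`; the term `N₀` puts the block
    -- beyond the Cauchy index.
    obtain ⟨i, hi⟩ : ∃ i, N₀ + 4 * L + 4 ≤ 2 ^ i := ⟨_, Nat.lt_two_pow_self.le⟩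
    set k := 2 ^ i with hk
    set M := 2 ^ (k - 1) with hM
    have hM1 : 1 ≤ M := Nat.one_le_two_pow
    have hkk : k < 2 ^ k := Nat.lt_two_pow_self
    have hS : ∀ N : ℕ, ∑ n ∈ Finset.Icc (-(N : ℤ)) (N : ℤ),
        c n • FourierLp.ofSchwartz 1 (translateTest χ (n : ℝ)) =
        FourierLp.ofSchwartz 1 (partialSynthesis χ c (Finset.Ico 1 ((N : ℤ) + 1))) := fun N => by
      rw [sum_Icc_neg_eq_sum_Ico _ fun n hn => ?_, FourierLp.sum_smul_ofSchwartz]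
      rw [hc, blockSeq, if_neg (by omega), zero_smul]
    -- These two symmetric sums differ exactly by the first half of block `k`.
    have hdist := hN₀ (2 ^ k + M - 1) (by omega) (2 ^ k - 1) (by omega)
    rw [hS, hS] at hdist
    have e1 : Finset.Ico 1 (((2 ^ k + M - 1 : ℕ) : ℤ) + 1) =
        Finset.Ico 1 (((2 ^ k - 1 : ℕ) : ℤ) + 1) ∪
        Finset.Ico ((2 ^ k : ℕ) : ℤ) ((2 ^ k + M : ℕ) : ℤ) := by
      have h1 : (((2 ^ k + M - 1 : ℕ) : ℤ) + 1) = ((2 ^ k + M : ℕ) : ℤ) := by omega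
      have h2 : (((2 ^ k - 1 : ℕ) : ℤ) + 1) = ((2 ^ k : ℕ) : ℤ) := by omega
      rw [h1, h2, Finset.Ico_union_Ico_eq_Ico (by omega) (by omega)]
    have e2 : Disjoint (Finset.Ico 1 (((2 ^ k - 1 : ℕ) : ℤ) + 1))
        (Finset.Ico ((2 ^ k : ℕ) : ℤ) ((2 ^ k + M : ℕ) : ℤ)) := by
      have h2 : (((2 ^ k - 1 : ℕ) : ℤ) + 1) = ((2 ^ k : ℕ) : ℤ) := by omega
      rw [h2]
      exact Finset.Ico_disjoint_Ico_consecutive _ _ _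
    have hk1 : 1 ≤ k := Nat.one_le_two_pow
    have hMk : 2 ^ k = M + M := h2k k hk1
    rw [dist_eq_norm, e1, partialSynthesis_union _ _ e2, FourierLp.ofSchwartz_add,
      add_sub_cancel_left, norm_ofSchwartz_partialSynthesis_Ico χ c (2 ^ k) M (dyadicWeight k) (b k)
        fun j hj => by rw [hc, blockSeq_two_pow_add _ (by omega)]] at hdist
    have hw : dyadicWeight k = (k : ℝ)⁻¹ := by
      rw [dyadicWeight, hk, Nat.log_pow one_lt_two, if_pos rfl]
    have hk0 : (0 : ℝ) < k := by exact_mod_cast hk1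
    have hlogM : Real.log (M * η) = (k - 1) * Real.log 2 + Real.log η := by
      rw [Real.log_mul (by positivity) hη.ne', hM]
      push_cast
      rw [Real.log_pow, Nat.cast_sub hk1, Nat.cast_one]
    have hki : (N₀ : ℝ) + 4 * L + 4 ≤ k := by exact_mod_cast hi
    have hL' : |Real.log η| ≤ L * Real.log 2 := (div_le_iff₀ hlog2).1 hL
    have hlogη := neg_abs_le (Real.log η)
    have hbig : k / 4 * Real.log 2 ≤ Real.log (M * η) := by
      rw [hlogM]
      have hN0 : (0 : ℝ) ≤ N₀ := Nat.cast_nonneg _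
      have hLn : (0 : ℝ) ≤ L := Nat.cast_nonneg _
      have : 0 ≤ ((k : ℝ) - 1 - L - k / 4) * Real.log 2 :=
        mul_nonneg (by linarith) hlog2.le
      nlinarith
    have hMη : 1 ≤ M * η := by
      have h0 : 0 < Real.log (M * η) := lt_of_lt_of_le (by positivity) hbig
      exact ((Real.log_pos_iff (by positivity)).1 h0).le
    have hl := hlow M hM1 hMη
    rw [hw, Complex.norm_real, Real.norm_of_nonneg (by positivity), inv_mul_lt_iff₀ hk0] at hdist
    have h5 := mul_le_mul_of_nonneg_left hbig hδ.le
    have h6 := h5.trans (hl.trans hdist.le)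
    have h7 := hl.trans_lt hdist
    nlinarith

theorem tendsto_Icc_neg_atTop : Tendsto (fun N : ℕ => Finset.Icc (-(N : ℤ)) N) atTop atTop := by
  refine tendsto_atTop_finset_of_monotone (fun a b h => ?_) fun n => ⟨n.natAbs, ?_⟩
  · exact Finset.Icc_subset_Icc (by omega) (by omega)
  · rw [Finset.mem_Icc]; omega

theorem proposition5p13 (χ : 𝓓(unitCell, ℂ)) (hχ : χ ≠ 0) :
    (∀ (p : ℝ≥0∞) [Fact (1 ≤ p)], p ≠ ∞ → p ≠ 2 →
      ∃ c : ℤ → ℂ,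
        (∀ ψ : 𝓓(unitCell, ℂ), ψ ≠ 0 → c ∈ discreteSpace (fourierLpSubmodule p) ψ) ∧
        ¬ Summable (fun n : ℤ => c n • FourierLp.ofSchwartz p (translateTest χ (n : ℝ)))) ∧
    (∃ c : ℤ → ℂ,
      (∀ ψ : 𝓓(unitCell, ℂ), ψ ≠ 0 → c ∈ discreteSpace (fourierLpSubmodule 1) ψ) ∧
      ¬ ∃ f : FourierLp 1,
        Tendsto
          (fun N : ℕ => ∑ n ∈ Finset.Icc (-(N : ℤ)) (N : ℤ),
            c n • FourierLp.ofSchwartz 1 (translateTest χ (n : ℝ)))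
          atTop (𝓝 f)) := by
  obtain ⟨c, hc, hdiv⟩ := exists_not_tendsto_symmetric χ hχ
  refine ⟨fun p hp1 hp hp2 => ?_, c, fun ψ _ => hc ψ, hdiv⟩
  rcases hp1.out.eq_or_lt with h | h
  · subst h
    -- Unconditional convergence would imply convergence along symmetric intervals.
    exact ⟨c, fun ψ _ => hc ψ, fun hs => hdiv ⟨_, hs.hasSum.comp tendsto_Icc_neg_atTop⟩⟩
  · obtain ⟨c', hc', hdiv'⟩ := exists_not_summable_of_one_lt χ hχ h hp hp2
    exact ⟨c', fun ψ _ => hc' ψ, hdiv'⟩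

end
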